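/- Conventions. A subspace of $\mathbb R^n$ is rational if it has a basis of vectors with rational coordinates; $\mathfrak R_n(e)$ is the set of rational subspaces of dimension $e$. For $B\in\mathfrak R_n(e)$, the height $H(B)$ is the Euclidean norm of an integer vector with setwise coprime coordinates in the class of Plücker coordinates of $B$. For nonzero $X,Y\in\mathbb R^n$ (with the standard Euclidean structure) let $\psi(X,Y)$ be the sine of the angle between $X$ and $Y$. For subspaces $A,B$ of $\mathbb R^n$ and $1\le j\le\min(\dim A,\dim B)$, the number $\psi_j(A,B)$ (the sine of the $j$-th canonical angle) is defined inductively: $\psi_i(A,B)=\psi(X_i,Y_i)$, where the unit vectors $X_i,Y_i$ minimize $\psi(X,Y)$ among all nonzero $X\in A$ orthogonal to $X_1,\dots,X_{i-1}$ and all nonzero $Y\in B$ orthogonal to $Y_1,\dots,Y_{i-1}$. Let $\mathfrak I_n(d,e)_j$ be the set of subspaces $A$ of $\mathbb R^n$ of dimension $d$ such that $\dim(A\cap B)<j$ for all $B\in\mathfrak R_n(e)$. For such $A$, let $\mu_n(A|e)_j\in[0,+\infty]$ be the supremum of all real $\beta>0$ such that $\psi_j(A,B)\le H(B)^{-\beta}$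 for infinitely many $B\in\mathfrak R_n(e)$, and let $\mathring\mu_n(d,e)_j=\inf_{A\in\mathfrak I_n(d,e)_j}\mu_n(A|e)_j$. Statement. Let $n,d,e,\ell,j$ be positive integers with $d+e\le n$, $1\le j\le \ell\le e$ and $j\le d$. Then every $A\in\mathfrak I_n(d,e)_j$ also lies in $\mathfrak I_n(d,\ell)_j$ and satisfies $$\mu_n(A|e)_j\ \ge\ \frac{n-\ell}{n-e}\cdot\mu_n(A|\ell)_j .$$ Consequently $$\mathring\mu_n(d,e)_j\ \ge\ \frac{n-\ell}{n-e}\cdot\mathring\mu_n(d,\ell)_j .$$ -/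

import Mathlib

noncomputable section

namespace SubspaceApprox

open Module

/-- A subspace `B` of `ℝⁿ` is rational if it has a basis of vectors with rational coordinates. -/
def IsRational {n : ℕ} (B : Submodule ℝ (EuclideanSpace ℝ (Fin n))) : Prop :=
  ∃ b : Basis (Fin (finrank ℝ B)) ℝ B,
    ∀ i k, ∃ q : ℚ, (b i : EuclideanSpace ℝ (Fin n)) k = (q : ℝ)

/-- The set `ℜₙ(e)` of rational subspaces of dimension `e` of `ℝⁿ`. -/
def rationalSubspaces (n e : ℕ) : Set (Submodule ℝ (EuclideanSpace ℝ (Fin n))) :=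
  {B | IsRational B ∧ finrank ℝ B = e}

/-- `A` is `(e, j)`-irrational if `dim (A ∩ B) < j` for every rational `B` of dimension `e`. -/
def IsIrrational {n : ℕ} (A : Submodule ℝ (EuclideanSpace ℝ (Fin n))) (e j : ℕ) : Prop :=
  ∀ B ∈ rationalSubspaces n e, finrank ℝ (A ⊓ B : Submodule ℝ (EuclideanSpace ℝ (Fin n))) < j

/-- The set `𝔍ₙ(d, e)_j` of `(e, j)`-irrational subspaces of dimension `d` of `ℝⁿ`. -/
def irrationalSubspaces (n d e j : ℕ) : Set (Submodule ℝ (EuclideanSpace ℝ (Fin n))) :=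
  {A | finrank ℝ A = d ∧ IsIrrational A e j}

/-- The Plücker coordinates of `v₁, …, vₑ`: the `e × e` minors of the matrix with these rows,
indexed by the increasing `e`-tuples of column indices. -/
def plucker {n e : ℕ} (v : Fin e → EuclideanSpace ℝ (Fin n)) (I : Fin e ↪o Fin n) : ℝ :=
  (Matrix.of fun a b : Fin e => v a (I b)).det

/-- `Ξ` is an integer vector with setwise coprime coordinates in the (projective) class of Plücker
coordinates of the `e`-dimensional subspace `B`. -/
def IsPrimitivePlucker {n : ℕ} (e : ℕ) (B : Submodule ℝ (EuclideanSpace ℝ (Fin n)))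
    (Ξ : (Fin e ↪o Fin n) → ℤ) : Prop :=
  Finset.univ.gcd Ξ = 1 ∧
    ∃ (b : Basis (Fin e) ℝ B) (c : ℝ), c ≠ 0 ∧
      ∀ I, (Ξ I : ℝ) = c * plucker (fun i => (b i : EuclideanSpace ℝ (Fin n))) I

open Classical in
/-- The height `H(B)` of a rational subspace `B` of dimension `e`: the Euclidean norm of a primitive
integer vector of Plücker coordinates. Such a vector is unique up to sign. (The value is `0` if
there is none, that is, if `B` is not a rational subspace of dimension `e`.) -/
def height {n : ℕ} (e : ℕ) (B : Submodule ℝ (EuclideanSpace ℝ (Fin n))) : ℝ :=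
  if h : ∃ Ξ : (Fin e ↪o Fin n) → ℤ, IsPrimitivePlucker e B Ξ then
    Real.sqrt (∑ I, ((h.choose I : ℤ) : ℝ) ^ 2)
  else 0

/-- `ψ(X, Y)`, the sine of the angle between the nonzero vectors `X` and `Y`. -/
def psiVec {n : ℕ} (X Y : EuclideanSpace ℝ (Fin n)) : ℝ :=
  Real.sin (InnerProductGeometry.angle X Y)

/-- The orthogonal complement in `A` of the span of `X₁, …, Xᵢ₋₁`. -/
def residualSubspace {n : ℕ} (A : Submodule ℝ (EuclideanSpace ℝ (Fin n)))
    (X : ℕ → EuclideanSpace ℝ (Fin n)) (i : ℕ) : Submodule ℝ (EuclideanSpace ℝ (Fin n)) :=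
  A ⊓ (Submodule.span ℝ (X '' Set.Ico 1 i))ᗮ

/-- `(X₁, Y₁), …, (Xⱼ, Yⱼ)` are pairs obtained by the inductive construction of the canonical angles
between `A` and `B`: for each `i`, the vectors `Xᵢ` and `Yᵢ` are unit vectors, in `A` orthogonal to
the earlier `X`'s and in `B` orthogonal to the earlier `Y`'s, and `ψ(Xᵢ, Yᵢ)` is minimal among all
pairs of nonzero vectors subject to these conditions. -/
def IsCanonicalSystem {n : ℕ} (A B : Submodule ℝ (EuclideanSpace ℝ (Fin n))) (j : ℕ)
    (X Y : ℕ → EuclideanSpace ℝ (Fin n)) : Prop :=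
  ∀ i, 1 ≤ i → i ≤ j →
    X i ∈ residualSubspace A X i ∧ ‖X i‖ = 1 ∧ Y i ∈ residualSubspace B Y i ∧ ‖Y i‖ = 1 ∧
      ∀ X' ∈ residualSubspace A X i, X' ≠ 0 → ∀ Y' ∈ residualSubspace B Y i, Y' ≠ 0 →
        psiVec (X i) (Y i) ≤ psiVec X' Y'

open Classical in
/-- `ψⱼ(A, B)`, the sine of the `j`-th canonical angle between `A` and `B`, for
`1 ≤ j ≤ min (dim A) (dim B)`; it does not depend on the choices of the vectors. (The value is `1`
if there is no canonical system of length `j`, that is, if `j > min (dim A) (dim B)`.) -/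
def psi {n : ℕ} (A B : Submodule ℝ (EuclideanSpace ℝ (Fin n))) (j : ℕ) : ℝ :=
  if h : ∃ P : (ℕ → EuclideanSpace ℝ (Fin n)) × (ℕ → EuclideanSpace ℝ (Fin n)),
      IsCanonicalSystem A B j P.1 P.2 then
    psiVec (h.choose.1 j) (h.choose.2 j)
  else 1

/-- The exponent `μₙ(A|e)_j ∈ [0, +∞]`: the supremum of all real `β > 0` such that
`ψⱼ(A, B) ≤ 1 / H(B) ^ β` for infinitely many rational subspaces `B` of dimension `e`. -/
def mu {n : ℕ} (A : Submodule ℝ (EuclideanSpace ℝ (Fin n))) (e j : ℕ) : ENNReal :=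
  sSup (ENNReal.ofReal '' {β : ℝ | 0 < β ∧
    {B | B ∈ rationalSubspaces n e ∧ psi A B j ≤ 1 / height e B ^ β}.Infinite})

/-- `μ̊ₙ(d, e)_j`, the infimum of `μₙ(A|e)_j` over all `A ∈ 𝔍ₙ(d, e)_j`. -/
def muInf (n d e j : ℕ) : ENNReal :=
  ⨅ A ∈ irrationalSubspaces n d e j, mu A e j

end SubspaceApprox

end

/-! Every rational `B` of dimension `ℓ` lies in a rational `C` of dimension `e` with `H(C) ≤ K *
H(B) ^ ((n - e) / (n - ℓ))`, where `K` does not depend on `B` (`exists_rational_superspace`).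
Enlarging `B` to `C` does not increase the `j`-th canonical sine (`psi_anti`), so an approximation
of `A` by `B` of quality `β` yields one by `C` of any quality `γ < β * (n - ℓ) / (n - e)`, once
`H(C)` is large enough to absorb `K`. Infinitely many `C` arise: a `C` shared by infinitely many `B`
would satisfy `ψⱼ(A, C) = 0`, hence `dim (A ∩ C) ≥ j` (`le_finrank_inf_of_psi_nonpos`), against
irrationality.

The superspace is built one dimension at a time (`exists_rational_succ`). Let `M` be the largest
absolute value of a primitive Plücker coordinate of `B`. A lattice attached to `B` has index at
least `M`, so the pigeonhole principle gives an integer vector `z` outside `B` at distance `≪ M ^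
(-1 / (n - ℓ))` from `B` in each coordinate. The integer Plücker coordinates of `B + ℝz` are then `≪
M ^ (1 - 1 / (n - ℓ))`. -/

namespace SubspaceApprox

open Module

/-! ### Canonical angles: biorthogonality, existence, monotonicity, vanishing. -/

section Angles

variable {n : ℕ}

theorem psiVec_eq_sqrt (X Y : EuclideanSpace ℝ (Fin n)) :
    psiVec X Y = √(1 - (inner ℝ X Y / (‖X‖ * ‖Y‖)) ^ 2) := by
  rw [psiVec, ← InnerProductGeometry.cos_angle]
  exact Real.sin_eq_sqrt_one_sub_cos_sq (InnerProductGeometry.angle_nonneg _ _)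
    (InnerProductGeometry.angle_le_pi _ _)

/-- The sine is `√(1 - cos²)`, so minimizing it means maximizing the absolute cosine. All later
arguments use this form, which is free of denominators. -/
theorem psiVec_le_psiVec_iff {X Y x y : EuclideanSpace ℝ (Fin n)} (hX : ‖X‖ = 1) (hY : ‖Y‖ = 1)
    (hx : x ≠ 0) (hy : y ≠ 0) :
    psiVec X Y ≤ psiVec x y ↔ |inner ℝ x y| ≤ |inner ℝ X Y| * (‖x‖ * ‖y‖) := by
  have hpos : 0 < ‖x‖ * ‖y‖ := mul_pos (norm_pos_iff.2 hx) (norm_pos_iff.2 hy)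
  have hle : |inner ℝ x y| ≤ ‖x‖ * ‖y‖ := abs_real_inner_le_norm x y
  rw [psiVec_eq_sqrt, psiVec_eq_sqrt, hX, hY, mul_one, div_one, ← div_le_iff₀ hpos,
    ← abs_of_pos hpos, ← abs_div, abs_of_pos hpos, ← sq_le_sq]
  rw [Real.sqrt_le_sqrt_iff]
  · constructor <;> intro h <;> linarith
  · have : (inner ℝ x y / (‖x‖ * ‖y‖)) ^ 2 ≤ 1 ^ 2 := by
      rw [sq_le_sq, abs_div, abs_of_pos hpos, abs_one]
      exact (div_le_one hpos).2 hle
    linarith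

theorem mem_residualSubspace {A : Submodule ℝ (EuclideanSpace ℝ (Fin n))}
    {X : ℕ → EuclideanSpace ℝ (Fin n)} {i : ℕ} {x : EuclideanSpace ℝ (Fin n)} :
    x ∈ residualSubspace A X i ↔ x ∈ A ∧ ∀ k, 1 ≤ k → k < i → inner ℝ (X k) x = 0 := by
  rw [residualSubspace, Submodule.mem_inf, Submodule.mem_orthogonal]
  refine and_congr_right fun _ => ⟨fun h k h1 h2 => h _ (Submodule.subset_span ⟨k, ⟨h1, h2⟩, rfl⟩),
    fun h u hu => ?_⟩
  induction hu using Submodule.span_induction with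
  | mem u hu => obtain ⟨k, hk, rfl⟩ := hu; exact h k hk.1 hk.2
  | zero => simp
  | add u v _ _ hu hv => rw [inner_add_left, hu, hv, add_zero]
  | smul a u _ hu => rw [real_inner_smul_left, hu, mul_zero]

theorem residualSubspace_anti (A : Submodule ℝ (EuclideanSpace ℝ (Fin n)))
    (X : ℕ → EuclideanSpace ℝ (Fin n)) {i k : ℕ} (h : i ≤ k) :
    residualSubspace A X k ≤ residualSubspace A X i := fun x hx => by
  rw [mem_residualSubspace] at hx ⊢
  exact ⟨hx.1, fun m h1 h2 => hx.2 m h1 (h2.trans_le h)⟩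

theorem residualSubspace_congr (A : Submodule ℝ (EuclideanSpace ℝ (Fin n)))
    {X X' : ℕ → EuclideanSpace ℝ (Fin n)} {i : ℕ} (h : ∀ k, k < i → X k = X' k) :
    residualSubspace A X i = residualSubspace A X' i := by
  ext x
  simp only [mem_residualSubspace]
  refine and_congr_right fun _ => forall_congr' fun k => forall_congr' fun _ => ?_
  exact ⟨fun H hk => h k hk ▸ H hk, fun H hk => (h k hk).symm ▸ H hk⟩

/-- A unit vector of a subspace `K` maximizing `|⟪·, y⟫|` is proportional to the projection
of `y` to `K`. -/
theorem inner_eq_zero_of_maximal {V : Type*} [NormedAddCommGroup V] [InnerProductSpace ℝ V]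
    {K : Submodule ℝ V} {X y x : V} (hXK : X ∈ K) (hX : ‖X‖ = 1)
    (hmax : ∀ u ∈ K, |inner ℝ u y| ≤ |inner ℝ X y| * ‖u‖) (hx : x ∈ K)
    (hXx : inner ℝ X x = 0) : inner ℝ x y = 0 := by
  set a := inner ℝ X y with ha
  set b := inner ℝ x y with hb
  rcases eq_or_ne a 0 with h0 | h0
  · have := hmax x hx
    rw [h0, abs_zero, zero_mul] at this
    exact abs_nonpos_iff.1 this
  by_contra hb0
  have hx0 : x ≠ 0 := fun h => hb0 (by rw [hb, h, inner_zero_left])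
  have hq : 0 < ‖x‖ ^ 2 := by positivity
  set t := b / ‖x‖ ^ 2 with ht
  have htb : t * ‖x‖ ^ 2 = b := div_mul_cancel₀ _ hq.ne'
  -- The test vector is the projection of `y` to the plane of `X` and `x`, so its inner product with
  -- `y` equals its squared norm; that norm exceeds `|a|` unless `b = 0`.
  have h1 := hmax (a • X + t • x) (K.add_mem (K.smul_mem _ hXK) (K.smul_mem _ hx))
  have h2 : inner ℝ (a • X + t • x) y = a ^ 2 + t * b := by
    rw [inner_add_left, real_inner_smul_left, real_inner_smul_left, ← ha, ← hb]; ring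
  have h3 : ‖a • X + t • x‖ ^ 2 = a ^ 2 + t * b := by
    rw [← real_inner_self_eq_norm_sq, inner_add_left, inner_add_right, inner_add_right]
    simp only [real_inner_smul_left, real_inner_smul_right, real_inner_comm X x, hXx,
      real_inner_self_eq_norm_sq, norm_smul, hX, mul_pow, Real.norm_eq_abs, sq_abs]
    linear_combination t * htb
  have h4 : (a ^ 2 + t * b) ^ 2 ≤ a ^ 2 * (a ^ 2 + t * b) := by
    have := pow_le_pow_left₀ (abs_nonneg _) h1 2
    rwa [sq_abs, mul_pow, sq_abs, h2, h3] at this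
  have htb' : 0 < t * b := by
    rw [ht, div_mul_eq_mul_div]
    exact div_pos (mul_self_pos.2 hb0) hq
  nlinarith [sq_nonneg a, mul_pos htb' htb', mul_pos htb' (by positivity : 0 < a ^ 2)]

variable {A B : Submodule ℝ (EuclideanSpace ℝ (Fin n))} {j : ℕ}
  {X Y : ℕ → EuclideanSpace ℝ (Fin n)}

theorem IsCanonicalSystem.abs_inner_le (h : IsCanonicalSystem A B j X Y) {i : ℕ} (h1 : 1 ≤ i)
    (hi : i ≤ j) {x y : EuclideanSpace ℝ (Fin n)} (hx : x ∈ residualSubspace A X i)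
    (hy : y ∈ residualSubspace B Y i) :
    |inner ℝ x y| ≤ |inner ℝ (X i) (Y i)| * (‖x‖ * ‖y‖) := by
  rcases eq_or_ne x 0 with rfl | hx0
  · simp
  rcases eq_or_ne y 0 with rfl | hy0
  · simp
  obtain ⟨-, hX, -, hY, hmin⟩ := h i h1 hi
  exact (psiVec_le_psiVec_iff hX hY hx0 hy0).1 (hmin x hx hx0 y hy hy0)

theorem IsCanonicalSystem.symm (h : IsCanonicalSystem A B j X Y) :
    IsCanonicalSystem B A j Y X := by
  have hc (u v : EuclideanSpace ℝ (Fin n)) : psiVec u v = psiVec v u := by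
    rw [psiVec, psiVec, InnerProductGeometry.angle_comm]
  intro i h1 hi
  obtain ⟨hX, hX1, hY, hY1, hmin⟩ := h i h1 hi
  refine ⟨hY, hY1, hX, hX1, fun y hy hy0 x hx hx0 => ?_⟩
  rw [hc, hc y]
  exact hmin x hx hx0 y hy hy0

/-- By maximality the projection of `Y i` to the `i`-th residual subspace of `A` is a multiple of `X
i`, so whatever is orthogonal to `X i` there is orthogonal to `Y i`. This is the source of
biorthogonality. -/
theorem IsCanonicalSystem.inner_eq_zero (h : IsCanonicalSystem A B j X Y) {i : ℕ} (h1 : 1 ≤ i)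
    (hi : i ≤ j) {x : EuclideanSpace ℝ (Fin n)} (hx : x ∈ residualSubspace A X (i + 1)) :
    inner ℝ x (Y i) = 0 := by
  obtain ⟨hX, hX1, hY, hY1, -⟩ := h i h1 hi
  refine inner_eq_zero_of_maximal hX hX1 (fun u hu => ?_)
    (residualSubspace_anti A X (Nat.le_succ i) hx)
    ((mem_residualSubspace.1 hx).2 i h1 (Nat.lt_succ_self i))
  simpa [hY1] using h.abs_inner_le h1 hi hu hY

theorem IsCanonicalSystem.inner_cross (h : IsCanonicalSystem A B j X Y) {i k : ℕ} (hi1 : 1 ≤ i)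
    (hi : i ≤ j) (hk1 : 1 ≤ k) (hk : k ≤ j) (hik : i ≠ k) : inner ℝ (X i) (Y k) = 0 := by
  rcases lt_or_gt_of_ne hik with hlt | hlt
  · rw [real_inner_comm]
    exact h.symm.inner_eq_zero hi1 hi (residualSubspace_anti _ _ hlt (h k hk1 hk).2.2.1)
  · exact h.inner_eq_zero hk1 hk (residualSubspace_anti _ _ hlt (h i hi1 hi).1)

theorem IsCanonicalSystem.inner_left (h : IsCanonicalSystem A B j X Y) {i k : ℕ} (hi1 : 1 ≤ i)
    (hi : i ≤ j) (hk1 : 1 ≤ k) (hk : k ≤ j) (hik : i ≠ k) : inner ℝ (X i) (X k) = 0 := by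
  rcases lt_or_gt_of_ne hik with hlt | hlt
  · exact (mem_residualSubspace.1 (h k hk1 hk).1).2 i hi1 hlt
  · rw [real_inner_comm]
    exact (mem_residualSubspace.1 (h i hi1 hi).1).2 k hk1 hlt

theorem IsCanonicalSystem.orthonormal (h : IsCanonicalSystem A B j X Y) :
    Orthonormal ℝ fun i : Fin j => X (i + 1) := by
  refine ⟨fun i => (h _ (by omega) (by omega)).2.1, fun i k hik => ?_⟩
  have : (i : ℕ) ≠ k := fun h => hik (Fin.ext h)
  exact h.inner_left (by omega) (by omega) (by omega) (by omega) (by omega)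

theorem IsCanonicalSystem.abs_inner_anti (h : IsCanonicalSystem A B j X Y) {i k : ℕ} (hi1 : 1 ≤ i)
    (hik : i ≤ k) (hk : k ≤ j) : |inner ℝ (X k) (Y k)| ≤ |inner ℝ (X i) (Y i)| := by
  obtain ⟨hX, hX1, hY, hY1, -⟩ := h k (hi1.trans hik) hk
  simpa [hX1, hY1] using h.abs_inner_le hi1 (hik.trans hk) (residualSubspace_anti _ _ hik hX)
    (residualSubspace_anti _ _ hik hY)

/-- Enlarging the second subspace does not decrease the cosine of the `j`-th canonical angle. -/
theorem IsCanonicalSystem.abs_inner_le_of_le {C : Submodule ℝ (EuclideanSpace ℝ (Fin n))}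
    {X' Y' : ℕ → EuclideanSpace ℝ (Fin n)} (hBC : B ≤ C) (hj : 1 ≤ j)
    (h : IsCanonicalSystem A B j X Y) (h' : IsCanonicalSystem A C j X' Y') :
    |inner ℝ (X j) (Y j)| ≤ |inner ℝ (X' j) (Y' j)| := by
  obtain ⟨m, rfl⟩ : ∃ m, j = m + 1 := ⟨j - 1, by omega⟩
  -- A kernel vector gives a combination `x` of the `m + 1` vectors `X i` that is orthogonal to `X'
  -- 1, …, X' m`, hence admissible at the last step for `C`.
  let L : (Fin (m + 1) → ℝ) →ₗ[ℝ] (Fin m → ℝ) :=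
    LinearMap.pi fun k => (innerₗ (EuclideanSpace ℝ (Fin n)) (X' (k + 1))).comp
      (Fintype.linearCombination ℝ fun i : Fin (m + 1) => X (i + 1))
  have hL : LinearMap.ker L ≠ ⊥ := L.ker_ne_bot_of_finrank_lt (by simp)
  obtain ⟨a, haL, ha0⟩ := (Submodule.ne_bot_iff _).1 hL
  set c := |inner ℝ (X (m + 1)) (Y (m + 1))| with hc
  set x := ∑ i : Fin (m + 1), a i • X (i + 1) with hx
  -- The signs make every term of `⟪x, y⟫` nonnegative.
  obtain ⟨ε, hε, hεc⟩ : ∃ ε : Fin (m + 1) → ℝ, (∀ i, ε i ^ 2 = 1) ∧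
      ∀ i, ε i * inner ℝ (X (i + 1)) (Y (i + 1)) = |inner ℝ (X (i + 1)) (Y (i + 1))| := by
    have (t : ℝ) : ∃ s : ℝ, s ^ 2 = 1 ∧ s * t = |t| := by
      rcases abs_choice t with ht | ht
      · exact ⟨1, by norm_num, by rw [ht, one_mul]⟩
      · exact ⟨-1, by norm_num, by rw [ht, neg_one_mul]⟩
    choose s hs hs' using this
    exact ⟨fun i => s _, fun i => hs _, fun i => hs' _⟩
  set y := ∑ i : Fin (m + 1), (a i * ε i) • Y (i + 1) with hy
  have hxn : ‖x‖ ^ 2 = ∑ i, a i ^ 2 := by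
    rw [← real_inner_self_eq_norm_sq, hx, h.orthonormal.inner_sum a a Finset.univ]
    simp [sq]
  have hyn : ‖y‖ ^ 2 = ∑ i, a i ^ 2 := by
    rw [← real_inner_self_eq_norm_sq, hy, h.symm.orthonormal.inner_sum _ _ Finset.univ]
    refine Finset.sum_congr rfl fun i _ => ?_
    simp only [conj_trivial]
    linear_combination a i ^ 2 * hε i
  have hxy : inner ℝ x y = ∑ i, a i ^ 2 * |inner ℝ (X (i + 1)) (Y (i + 1))| := by
    rw [hx, hy, sum_inner]
    refine Finset.sum_congr rfl fun i _ => ?_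
    rw [inner_sum, Finset.sum_eq_single i]
    · rw [real_inner_smul_left, real_inner_smul_right, ← hεc]; ring
    · intro k _ hk
      have : (i : ℕ) ≠ k := fun h => hk (Fin.ext h.symm)
      rw [real_inner_smul_left, real_inner_smul_right,
        h.inner_cross (by omega) (by omega) (by omega) (by omega) (by omega), mul_zero, mul_zero]
    · simp
  have hxy' : c * (∑ i, a i ^ 2) ≤ inner ℝ x y := by
    rw [hxy, Finset.mul_sum]
    refine Finset.sum_le_sum fun i _ => ?_
    rw [mul_comm]
    exact mul_le_mul_of_nonneg_left (h.abs_inner_anti (by omega) (by omega) le_rfl) (sq_nonneg _)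
  have hapos : 0 < ∑ i, a i ^ 2 := by
    obtain ⟨i, hi⟩ := Function.ne_iff.1 ha0
    exact Finset.sum_pos' (fun i _ => sq_nonneg _) ⟨i, Finset.mem_univ _, by
      have : a i ≠ 0 := hi
      positivity⟩
  have hxA : x ∈ A := A.sum_mem fun i _ =>
    A.smul_mem _ (mem_residualSubspace.1 (h _ (by omega) (by omega)).1).1
  have hyC : y ∈ C := C.sum_mem fun i _ =>
    C.smul_mem _ (hBC (mem_residualSubspace.1 (h _ (by omega) (by omega)).2.2.1).1)
  have hxres : x ∈ residualSubspace A X' (m + 1) := by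
    refine mem_residualSubspace.2 ⟨hxA, fun k hk1 hk => ?_⟩
    have := congrFun (LinearMap.mem_ker.1 haL) ⟨k - 1, by omega⟩
    simpa only [L, LinearMap.pi_apply, LinearMap.comp_apply, innerₗ_apply_apply,
      Fintype.linearCombination_apply, Nat.sub_add_cancel hk1, Pi.zero_apply] using this
  have horth : Orthonormal ℝ fun k : Fin m => Y' (k + 1) :=
    h'.symm.orthonormal.comp Fin.castSucc (Fin.castSucc_injective m)
  -- Subtracting the projection `z` of `y` to the span of `Y' 1, …, Y' m` makes `y` admissible for
  -- `C`. It leaves `⟪x, y⟫` unchanged, since `x` is orthogonal to these vectors, and does not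
  -- increase the norm.
  set z := ∑ k : Fin m, inner ℝ (Y' (k + 1)) y • Y' (k + 1) with hz
  have hzY (k : Fin m) : inner ℝ (Y' (k + 1)) z = inner ℝ (Y' (k + 1)) y := by
    rw [hz]; exact horth.inner_right_fintype _ _
  have hyz : y - z ∈ residualSubspace C Y' (m + 1) := by
    refine mem_residualSubspace.2 ⟨C.sub_mem hyC (C.sum_mem fun k _ => C.smul_mem _
      (mem_residualSubspace.1 (h' _ (by omega) (by omega)).2.2.1).1), fun k hk1 hk => ?_⟩
    have := hzY ⟨k - 1, by omega⟩
    simp only [Nat.sub_add_cancel hk1] at this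
    rw [inner_sub_right, this, sub_self]
  have hxz : inner ℝ x z = 0 := by
    rw [hz, inner_sum]
    refine Finset.sum_eq_zero fun k _ => ?_
    rw [real_inner_smul_right, h'.inner_eq_zero (by omega) (by omega)
      (residualSubspace_anti _ _ (by omega) hxres), mul_zero]
  have hzz : inner ℝ (y - z) z = 0 := by
    rw [hz, inner_sum, ← hz]
    refine Finset.sum_eq_zero fun k _ => ?_
    rw [real_inner_smul_right, real_inner_comm (Y' _), inner_sub_right, hzY, sub_self, mul_zero]
  have hyzn : ‖y - z‖ ≤ ‖y‖ := by
    have := norm_add_sq_eq_norm_sq_add_norm_sq_of_inner_eq_zero _ _ hzz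
    rw [sub_add_cancel] at this
    exact abs_le_of_sq_le_sq' (by nlinarith) (norm_nonneg _) |>.2
  have hnn : ‖x‖ * ‖y - z‖ ≤ ∑ i, a i ^ 2 := by
    have hxy_eq : ‖x‖ = ‖y‖ := by
      rw [← sq_eq_sq₀ (norm_nonneg _) (norm_nonneg _), hxn, hyn]
    calc ‖x‖ * ‖y - z‖ ≤ ‖x‖ * ‖x‖ := by
          rw [hxy_eq]; exact mul_le_mul_of_nonneg_left hyzn (norm_nonneg _)
      _ = _ := by rw [← sq, hxn]
  have hmax := h'.abs_inner_le hj le_rfl hxres hyz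
  rw [inner_sub_right, hxz, sub_zero] at hmax
  have := hxy'.trans ((le_abs_self _).trans
    (hmax.trans (mul_le_mul_of_nonneg_left hnn (abs_nonneg _))))
  exact le_of_mul_le_mul_right this hapos

theorem exists_mem_norm_eq_one {V : Type*} [NormedAddCommGroup V] [NormedSpace ℝ V]
    {K : Submodule ℝ V} (hK : K ≠ ⊥) : ∃ x ∈ K, ‖x‖ = 1 := by
  obtain ⟨x, hx, hx0⟩ := (Submodule.ne_bot_iff _).1 hK
  exact ⟨(‖x‖⁻¹ : ℝ) • x, K.smul_mem _ hx, norm_smul_inv_norm hx0⟩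

theorem residualSubspace_ne_bot (A : Submodule ℝ (EuclideanSpace ℝ (Fin n)))
    (X : ℕ → EuclideanSpace ℝ (Fin n)) {i : ℕ} (hi : 1 ≤ i) (hiA : i ≤ finrank ℝ A) :
    residualSubspace A X i ≠ ⊥ := by
  let L : A →ₗ[ℝ] (Fin (i - 1) → ℝ) :=
    LinearMap.pi fun k => (innerₗ (EuclideanSpace ℝ (Fin n)) (X (k + 1))).comp A.subtype
  have hL : LinearMap.ker L ≠ ⊥ := L.ker_ne_bot_of_finrank_lt (by
    rw [finrank_fin_fun]; omega)
  obtain ⟨a, haL, ha0⟩ := (Submodule.ne_bot_iff _).1 hL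
  refine (Submodule.ne_bot_iff _).2 ⟨a, mem_residualSubspace.2 ⟨a.2, fun k hk1 hk => ?_⟩,
    fun h => ha0 (Subtype.ext h)⟩
  have := congrFun (LinearMap.mem_ker.1 haL) ⟨k - 1, by omega⟩
  simpa [L, Nat.sub_add_cancel hk1] using this

/-- A system is extended by a maximizer of `|⟪x, y⟫|` on the product of the unit spheres of the
residual subspaces. These are compact, and nonempty by the dimension bounds. -/
theorem exists_isCanonicalSystem (hA : j ≤ finrank ℝ A) (hB : j ≤ finrank ℝ B) :
    ∃ X Y, IsCanonicalSystem A B j X Y := by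
  induction j with
  | zero => exact ⟨0, 0, fun i h1 hi => by omega⟩
  | succ j ih =>
    obtain ⟨X, Y, h⟩ := ih (by omega) (by omega)
    have hcompact (K : Submodule ℝ (EuclideanSpace ℝ (Fin n))) :
        IsCompact ((K : Set (EuclideanSpace ℝ (Fin n))) ∩ Metric.sphere 0 1) :=
      (isCompact_sphere 0 1).inter_left K.closed_of_finiteDimensional
    obtain ⟨x₀, hx₀, hx₀1⟩ := exists_mem_norm_eq_one (residualSubspace_ne_bot A X (by omega) hA)
    obtain ⟨y₀, hy₀, hy₀1⟩ := exists_mem_norm_eq_one (residualSubspace_ne_bot B Y (by omega) hB)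
    obtain ⟨⟨x, y⟩, ⟨⟨hx, hx1⟩, hy, hy1⟩, hmax⟩ :=
      ((hcompact (residualSubspace A X (j + 1))).prod
        (hcompact (residualSubspace B Y (j + 1)))).exists_isMaxOn
        (f := fun p => |inner ℝ p.1 p.2|)
        ⟨(x₀, y₀), ⟨hx₀, by simpa using hx₀1⟩, hy₀, by simpa using hy₀1⟩ (by fun_prop)
    have hX' (k : ℕ) (hk : k < j + 1) : Function.update X (j + 1) x k = X k :=
      Function.update_of_ne hk.ne _ _
    have hY' (k : ℕ) (hk : k < j + 1) : Function.update Y (j + 1) y k = Y k :=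
      Function.update_of_ne hk.ne _ _
    refine ⟨Function.update X (j + 1) x, Function.update Y (j + 1) y, fun i h1 hi => ?_⟩
    rw [residualSubspace_congr A fun k hk => hX' k (hk.trans_le hi),
      residualSubspace_congr B fun k hk => hY' k (hk.trans_le hi)]
    rcases Nat.lt_or_ge i (j + 1) with hlt | hge
    · rw [hX' i hlt, hY' i hlt]
      exact h i h1 (Nat.le_of_lt_succ hlt)
    obtain rfl : i = j + 1 := le_antisymm hi hge
    rw [Function.update_self, Function.update_self]
    have hx1 : ‖x‖ = 1 := by simpa using hx1
    have hy1 : ‖y‖ = 1 := by simpa using hy1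
    refine ⟨hx, hx1, hy, hy1, fun u hu hu0 v hv hv0 => ?_⟩
    rw [psiVec_le_psiVec_iff hx1 hy1 hu0 hv0]
    have hmem : ((‖u‖⁻¹ : ℝ) • u, (‖v‖⁻¹ : ℝ) • v) ∈
        ((residualSubspace A X (j + 1) : Set (EuclideanSpace ℝ (Fin n))) ∩ Metric.sphere 0 1) ×ˢ
        ((residualSubspace B Y (j + 1) : Set (EuclideanSpace ℝ (Fin n))) ∩ Metric.sphere 0 1) :=
      ⟨⟨Submodule.smul_mem _ _ hu, by simpa using norm_smul_inv_norm (𝕜 := ℝ) hu0⟩,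
        Submodule.smul_mem _ _ hv, by simpa using norm_smul_inv_norm (𝕜 := ℝ) hv0⟩
    have := hmax hmem
    simp only [Set.mem_ofPred_eq, real_inner_smul_left, real_inner_smul_right, abs_mul, abs_inv,
      abs_norm] at this
    have hu' := norm_pos_iff.2 hu0
    have hv' := norm_pos_iff.2 hv0
    rw [← mul_assoc, ← mul_inv, mul_comm, ← div_eq_mul_inv, div_le_iff₀ (by positivity)] at this
    rwa [mul_comm ‖u‖]

theorem exists_isCanonicalSystem_psi_eq (hA : j ≤ finrank ℝ A) (hB : j ≤ finrank ℝ B) :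
    ∃ X Y, IsCanonicalSystem A B j X Y ∧ psi A B j = psiVec (X j) (Y j) := by
  have h : ∃ P : (ℕ → EuclideanSpace ℝ (Fin n)) × (ℕ → EuclideanSpace ℝ (Fin n)),
      IsCanonicalSystem A B j P.1 P.2 := by
    obtain ⟨X, Y, h⟩ := exists_isCanonicalSystem hA hB
    exact ⟨(X, Y), h⟩
  exact ⟨_, _, h.choose_spec, by rw [psi, dif_pos h]⟩

theorem psi_anti {C : Submodule ℝ (EuclideanSpace ℝ (Fin n))} (hBC : B ≤ C) (hj : 1 ≤ j)
    (hA : j ≤ finrank ℝ A) (hB : j ≤ finrank ℝ B) : psi A C j ≤ psi A B j := by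
  obtain ⟨X, Y, h, hpsi⟩ := exists_isCanonicalSystem_psi_eq hA hB
  obtain ⟨X', Y', h', hpsi'⟩ :=
    exists_isCanonicalSystem_psi_eq hA (hB.trans (Submodule.finrank_mono hBC))
  obtain ⟨-, hX, -, hY, -⟩ := h j hj le_rfl
  obtain ⟨-, hX', -, hY', -⟩ := h' j hj le_rfl
  rw [hpsi, hpsi', psiVec_le_psiVec_iff hX' hY' (norm_ne_zero_iff.1 (by simp [hX]))
    (norm_ne_zero_iff.1 (by simp [hY])), hX, hY, mul_one, mul_one]
  exact h.abs_inner_le_of_le hBC hj h'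

/-- If the `j`-th cosine is `±1`, so are all the earlier ones. Then `X i = ± Y i` for all `i ≤ j`,
and these are orthonormal vectors of `A ⊓ B`. -/
theorem le_finrank_inf_of_psi_nonpos (hj : 1 ≤ j) (hA : j ≤ finrank ℝ A) (hB : j ≤ finrank ℝ B)
    (hpsi : psi A B j ≤ 0) :
    j ≤ finrank ℝ (A ⊓ B : Submodule ℝ (EuclideanSpace ℝ (Fin n))) := by
  obtain ⟨X, Y, h, hpsi'⟩ := exists_isCanonicalSystem_psi_eq hA hB
  obtain ⟨-, hXj, -, hYj, -⟩ := h j hj le_rfl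
  have hone : 1 ≤ |inner ℝ (X j) (Y j)| := by
    rw [hpsi', psiVec_eq_sqrt, hXj, hYj, mul_one, div_one] at hpsi
    have := Real.sqrt_eq_zero'.1 (le_antisymm hpsi (Real.sqrt_nonneg _))
    rw [← abs_one, ← sq_le_sq]; linarith
  have hmem (i : Fin j) : X (i + 1) ∈ A ⊓ B := by
    obtain ⟨hX, hX1, hY, hY1, -⟩ := h (i + 1) (by omega) (by omega)
    have h1 := hone.trans (h.abs_inner_anti (i := i + 1) (by omega) (by omega) le_rfl)
    have h2 := abs_real_inner_le_norm (X (i + 1)) (Y (i + 1))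
    rw [hX1, hY1, mul_one] at h2
    refine ⟨(mem_residualSubspace.1 hX).1, ?_⟩
    have hYB := (mem_residualSubspace.1 hY).1
    rcases abs_choice (inner ℝ (X (i + 1)) (Y (i + 1))) with ha | ha
    · rw [(inner_eq_one_iff_of_norm_eq_one hX1 hY1).1 (ha ▸ le_antisymm h2 h1)]
      exact hYB
    · rw [(inner_eq_neg_one_iff_of_norm_eq_one hX1 hY1 (𝕜 := ℝ)).1
        (by linarith)]
      exact B.neg_mem hYB
  have hli : LinearIndependent ℝ fun i : Fin j => (⟨X (i + 1), hmem i⟩ : (A ⊓ B : Submodule ℝ _)) :=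
    LinearIndependent.of_comp (A ⊓ B : Submodule ℝ _).subtype h.orthonormal.linearIndependent
  simpa using hli.fintype_card_le_finrank

end Angles

/-! ### Plücker coordinates, primitive vectors and finiteness for bounded height. -/

section Plucker

variable {n e : ℕ}

theorem plucker_cons (x : EuclideanSpace ℝ (Fin n)) (v : Fin e → EuclideanSpace ℝ (Fin n))
    (J : Fin (e + 1) ↪o Fin n) :
    plucker (Fin.cons x v : Fin (e + 1) → EuclideanSpace ℝ (Fin n)) J =
      ∑ k : Fin (e + 1), (-1) ^ (k : ℕ) * x (J k) *
        plucker v ((Fin.succAboveOrderEmb k).trans J) := by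
  rw [plucker, Matrix.det_succ_row_zero]
  refine Finset.sum_congr rfl fun k _ => ?_
  simp only [Matrix.of_apply, Fin.cons_zero, plucker]
  congr 2

theorem plucker_linearCombination {T : Matrix (Fin e) (Fin e) ℝ}
    {v w : Fin e → EuclideanSpace ℝ (Fin n)} (h : ∀ a, w a = ∑ k, T a k • v k)
    (I : Fin e ↪o Fin n) : plucker w I = T.det * plucker v I := by
  rw [plucker, plucker, ← Matrix.det_mul]
  congr 1
  ext a b
  simp [Matrix.mul_apply, h]

/-- Row rank equals column rank: `e` independent columns exist, and their indices are sorted because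
the coordinates are indexed by increasing tuples. -/
theorem exists_plucker_ne_zero {v : Fin e → EuclideanSpace ℝ (Fin n)}
    (hv : LinearIndependent ℝ v) : ∃ I, plucker v I ≠ 0 := by
  let M : Matrix (Fin e) (Fin n) ℝ := Matrix.of fun a k => v a k
  have hM : LinearIndependent ℝ M.row :=
    hv.map' (WithLp.linearEquiv 2 ℝ (Fin n → ℝ)).toLinearMap (LinearEquiv.ker _)
  have hrank : M.rank = e := by simpa using hM.rank_matrix
  obtain ⟨κ, a, ha, hspan, hli⟩ := exists_linearIndependent' ℝ M.col
  have : Finite κ := Finite.of_injective a ha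
  have : Fintype κ := Fintype.ofFinite κ
  have hcard : Fintype.card κ = e := by
    rw [← finrank_span_eq_card hli, hspan, ← M.rank_eq_finrank_span_cols, hrank]
  have hs : (Finset.univ.image a).card = e := by
    rw [Finset.card_image_of_injective _ ha, Finset.card_univ, hcard]
  let I := (Finset.univ.image a).orderEmbOfFin hs
  have hI (i : Fin e) : ∃ k, a k = I i := by
    obtain ⟨k, -, hk⟩ := Finset.mem_image.1 ((Finset.univ.image a).orderEmbOfFin_mem hs i)
    exact ⟨k, hk⟩
  choose f hf using hI
  have hfinj : Function.Injective f := fun i k hik => I.injective (by rw [← hf, ← hf, hik])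
  refine ⟨I, ?_⟩
  have hcols : LinearIndependent ℝ (Matrix.of fun a b : Fin e => v a (I b)).col := by
    have : (Matrix.of fun a b : Fin e => v a (I b)).col = (M.col ∘ a) ∘ f := by
      ext i k
      simp [hf, M]
    rw [this]
    exact hli.comp f hfinj
  exact ((Matrix.isUnit_iff_isUnit_det _).1
    (Matrix.linearIndependent_cols_iff_isUnit.1 hcols)).ne_zero

theorem linearIndependent_of_plucker_ne_zero {v : Fin e → EuclideanSpace ℝ (Fin n)}
    {I : Fin e ↪o Fin n} (h : plucker v I ≠ 0) : LinearIndependent ℝ v := by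
  have hrows := Matrix.linearIndependent_rows_iff_isUnit.2
    ((Matrix.isUnit_iff_isUnit_det _).2 (isUnit_iff_ne_zero.2 h))
  let L : EuclideanSpace ℝ (Fin n) →ₗ[ℝ] (Fin e → ℝ) :=
    (LinearMap.funLeft ℝ ℝ I).comp (WithLp.linearEquiv 2 ℝ (Fin n → ℝ)).toLinearMap
  exact LinearIndependent.of_comp L hrows

/-- A subspace is cut out by the linear equations given by its Plücker coordinates. -/
theorem mem_span_range_iff_plucker_cons {v : Fin e → EuclideanSpace ℝ (Fin n)}
    (hv : LinearIndependent ℝ v) (x : EuclideanSpace ℝ (Fin n)) :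
    x ∈ Submodule.span ℝ (Set.range v) ↔
      ∀ J, plucker (Fin.cons x v : Fin (e + 1) → EuclideanSpace ℝ (Fin n)) J = 0 := by
  constructor
  · intro hx J
    by_contra h
    exact (linearIndependent_finCons.1 (linearIndependent_of_plucker_ne_zero h)).2 hx
  · intro h
    by_contra hx
    obtain ⟨J, hJ⟩ := exists_plucker_ne_zero (linearIndependent_finCons.2 ⟨hv, hx⟩)
    exact hJ (h J)

theorem span_le_of_plucker {v w : Fin e → EuclideanSpace ℝ (Fin n)}
    (hv : LinearIndependent ℝ v) (hw : LinearIndependent ℝ w) {c : ℝ}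
    (h : ∀ I, plucker w I = c * plucker v I) :
    Submodule.span ℝ (Set.range v) ≤ Submodule.span ℝ (Set.range w) := by
  intro x hx
  rw [mem_span_range_iff_plucker_cons hv] at hx
  rw [mem_span_range_iff_plucker_cons hw]
  intro J
  rw [plucker_cons]
  simp only [h]
  rw [← mul_zero c, ← hx J, plucker_cons, Finset.mul_sum]
  exact Finset.sum_congr rfl fun k _ => by ring

theorem coe_basis_linearIndependent {B : Submodule ℝ (EuclideanSpace ℝ (Fin n))}
    (b : Basis (Fin e) ℝ B) : LinearIndependent ℝ fun i => (b i : EuclideanSpace ℝ (Fin n)) :=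
  b.linearIndependent.map' B.subtype B.ker_subtype

theorem span_range_coe_basis {B : Submodule ℝ (EuclideanSpace ℝ (Fin n))}
    (b : Basis (Fin e) ℝ B) :
    Submodule.span ℝ (Set.range fun i => (b i : EuclideanSpace ℝ (Fin n))) = B := by
  have : (Set.range fun i => (b i : EuclideanSpace ℝ (Fin n))) = B.subtype '' Set.range b := by
    rw [← Set.range_comp]; rfl
  rw [this, Submodule.span_image, b.span_eq, Submodule.map_top, Submodule.range_subtype]

theorem exists_basis_of_span_eq {B : Submodule ℝ (EuclideanSpace ℝ (Fin n))}
    {v : Fin e → EuclideanSpace ℝ (Fin n)} (hv : LinearIndependent ℝ v)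
    (hB : Submodule.span ℝ (Set.range v) = B) :
    ∃ b : Basis (Fin e) ℝ B, ∀ i, (b i : EuclideanSpace ℝ (Fin n)) = v i := by
  subst hB
  exact ⟨Basis.span hv, fun i => congrArg Subtype.val (Basis.span_apply hv i)⟩

theorem mem_rationalSubspaces_iff {B : Submodule ℝ (EuclideanSpace ℝ (Fin n))} :
    B ∈ rationalSubspaces n e ↔ ∃ v : Fin e → EuclideanSpace ℝ (Fin n), LinearIndependent ℝ v ∧
      Submodule.span ℝ (Set.range v) = B ∧ ∀ i k, ∃ q : ℚ, v i k = q := by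
  constructor
  · rintro ⟨⟨b, hb⟩, rfl⟩
    exact ⟨_, coe_basis_linearIndependent b, span_range_coe_basis b, hb⟩
  · rintro ⟨v, hv, hB, hq⟩
    obtain ⟨b, hb⟩ := exists_basis_of_span_eq hv hB
    obtain rfl : finrank ℝ B = e := by simpa using finrank_eq_card_basis b
    exact ⟨⟨b, fun i k => by rw [hb]; exact hq i k⟩, rfl⟩

theorem exists_plucker_basis_eq {B : Submodule ℝ (EuclideanSpace ℝ (Fin n))}
    (b b' : Basis (Fin e) ℝ B) : ∃ t : ℝ, ∀ I,
      plucker (fun i => (b' i : EuclideanSpace ℝ (Fin n))) I =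
        t * plucker (fun i => (b i : EuclideanSpace ℝ (Fin n))) I := by
  refine ⟨Matrix.det (Matrix.of fun i k => b.repr (b' i) k), fun I =>
    plucker_linearCombination (fun i => ?_) I⟩
  have := congrArg B.subtype (b.sum_repr (b' i))
  simpa only [map_sum, map_smul, Submodule.subtype_apply, Matrix.of_apply] using this.symm

/-- Bézout writes `1 = ∑ Ξ i * f i`, whence `t = ∑ (t * Ξ i) * f i`. This makes the real ratio of an
integer Plücker vector to a primitive one an integer. -/
theorem exists_int_eq_of_gcd_eq_one {ι : Type*} [Fintype ι] {Ξ : ι → ℤ}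
    (h : Finset.univ.gcd Ξ = 1) {t : ℝ} (ht : ∀ i, ∃ m : ℤ, t * Ξ i = m) : ∃ m : ℤ, t = m := by
  obtain ⟨f, hf⟩ := Finset.gcd_eq_sum_mul Finset.univ Ξ
  choose m hm using ht
  refine ⟨∑ i, m i * f i, ?_⟩
  push_cast
  have : (1 : ℝ) = ∑ i, (Ξ i : ℝ) * f i := by
    rw [h] at hf; exact_mod_cast hf
  rw [← mul_one t, this, Finset.mul_sum]
  exact Finset.sum_congr rfl fun i _ => by rw [← hm, mul_assoc]

theorem exists_isPrimitivePlucker {B : Submodule ℝ (EuclideanSpace ℝ (Fin n))}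
    (hB : B ∈ rationalSubspaces n e) : ∃ Ξ, IsPrimitivePlucker e B Ξ := by
  obtain ⟨v, hv, hspan, hq⟩ := mem_rationalSubspaces_iff.1 hB
  obtain ⟨b, hb⟩ := exists_basis_of_span_eq hv hspan
  choose q hq using hq
  let p : (Fin e ↪o Fin n) → ℚ := fun I => (Matrix.of fun i k : Fin e => q i (I k)).det
  have hp (I) : plucker v I = p I := by
    rw [plucker, ← Rat.coe_castHom (α := ℝ), RingHom.map_det]
    congr 1
    ext i k
    simp [hq]
  obtain ⟨I₀, hI₀⟩ := exists_plucker_ne_zero hv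
  -- `D` is a common denominator of the minors; dividing the cleared minors by their gcd then gives
  -- a primitive vector.
  obtain ⟨D, hD⟩ := IsLocalization.exist_integer_multiples_of_finset (nonZeroDivisors ℤ)
    (Finset.univ.image p)
  have hD0 : ((D : ℤ) : ℝ) ≠ 0 := by exact_mod_cast nonZeroDivisors.coe_ne_zero D
  have hm (I) : ∃ m : ℤ, (m : ℝ) = (D : ℤ) * plucker v I := by
    obtain ⟨m, hm⟩ := hD (p I) (Finset.mem_image_of_mem _ (Finset.mem_univ _))
    refine ⟨m, ?_⟩
    rw [hp]
    have : (m : ℚ) = (D : ℤ) * p I := by simpa using hm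
    exact_mod_cast this
  choose m hm using hm
  obtain ⟨Ξ, hΞ, hgcd⟩ := Finset.extract_gcd m ⟨I₀, Finset.mem_univ _⟩
  set g := Finset.univ.gcd m with hg
  have hg0 : (g : ℝ) ≠ 0 := by
    have : g ≠ 0 := fun h => by
      have := (Finset.gcd_eq_zero_iff.1 h) I₀ (Finset.mem_univ _)
      have h2 := hm I₀
      rw [this, Int.cast_zero] at h2
      exact (mul_ne_zero hD0 hI₀) h2.symm
    exact_mod_cast this
  refine ⟨Ξ, hgcd, b, (g : ℝ)⁻¹ * (D : ℤ), mul_ne_zero (inv_ne_zero hg0) hD0, fun I => ?_⟩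
  simp only [hb]
  rw [mul_assoc, ← hm, hΞ I (Finset.mem_univ _)]
  push_cast
  field_simp

theorem exists_isPrimitivePlucker_height_eq {B : Submodule ℝ (EuclideanSpace ℝ (Fin n))}
    (hB : B ∈ rationalSubspaces n e) :
    ∃ Ξ : (Fin e ↪o Fin n) → ℤ, IsPrimitivePlucker e B Ξ ∧
      height e B = √(∑ I, (Ξ I : ℝ) ^ 2) := by
  have h := exists_isPrimitivePlucker hB
  exact ⟨_, h.choose_spec, by rw [height, dif_pos h]⟩

theorem IsPrimitivePlucker.exists_ne_zero {B : Submodule ℝ (EuclideanSpace ℝ (Fin n))}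
    {Ξ : (Fin e ↪o Fin n) → ℤ} (h : IsPrimitivePlucker e B Ξ) : ∃ I, Ξ I ≠ 0 := by
  by_contra! h0
  have := h.1
  rw [Finset.gcd_eq_zero_iff.2 fun I _ => h0 I] at this
  exact zero_ne_one this

theorem abs_le_sqrt_sum_sq {ι : Type*} [Fintype ι] (f : ι → ℝ) (i : ι) :
    |f i| ≤ √(∑ k, f k ^ 2) :=
  Real.abs_le_sqrt (Finset.single_le_sum (f := fun k => f k ^ 2) (fun _ _ => sq_nonneg _)
    (Finset.mem_univ i))

theorem one_le_height {B : Submodule ℝ (EuclideanSpace ℝ (Fin n))}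
    (hB : B ∈ rationalSubspaces n e) : 1 ≤ height e B := by
  obtain ⟨Ξ, hΞ, h⟩ := exists_isPrimitivePlucker_height_eq hB
  obtain ⟨I, hI⟩ := hΞ.exists_ne_zero
  rw [h]
  refine le_trans ?_ (abs_le_sqrt_sum_sq _ I)
  exact_mod_cast Int.one_le_abs hI

/-- The height is at most the norm of any integer vector of Plücker coordinates. -/
theorem height_le_of_int_plucker {B : Submodule ℝ (EuclideanSpace ℝ (Fin n))}
    (hB : B ∈ rationalSubspaces n e) (b : Basis (Fin e) ℝ B) {c : ℝ} (hc : c ≠ 0)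
    {P : (Fin e ↪o Fin n) → ℤ}
    (hP : ∀ I, (P I : ℝ) = c * plucker (fun i => (b i : EuclideanSpace ℝ (Fin n))) I) :
    height e B ≤ √(∑ I, (P I : ℝ) ^ 2) := by
  obtain ⟨Ξ, hΞ, h⟩ := exists_isPrimitivePlucker_height_eq hB
  obtain ⟨hgcd, b', c', hc', hΞ'⟩ := hΞ
  obtain ⟨t, ht⟩ := exists_plucker_basis_eq b' b
  have hPΞ (I) : (c * t / c') * Ξ I = P I := by
    rw [hΞ', hP, ht]; field_simp
  obtain ⟨m, hm⟩ := exists_int_eq_of_gcd_eq_one hgcd fun I => ⟨_, hPΞ I⟩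
  obtain ⟨I, hI⟩ := exists_plucker_ne_zero (coe_basis_linearIndependent b)
  have hm0 : m ≠ 0 := fun h0 => by
    have := hPΞ I
    rw [hm, h0, Int.cast_zero, zero_mul, hP] at this
    exact mul_ne_zero hc hI this.symm
  have hm1 : (1 : ℝ) ≤ (m : ℝ) ^ 2 := by
    have := Int.one_le_abs hm0
    rw [← sq_abs, ← Int.cast_abs]
    exact one_le_pow₀ (by exact_mod_cast this)
  rw [h]
  refine Real.sqrt_le_sqrt (Finset.sum_le_sum fun I _ => ?_)
  rw [← hPΞ, hm, mul_pow]
  exact le_mul_of_one_le_left (sq_nonneg _) hm1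

theorem IsPrimitivePlucker.le {B C : Submodule ℝ (EuclideanSpace ℝ (Fin n))}
    {Ξ : (Fin e ↪o Fin n) → ℤ} (hB : IsPrimitivePlucker e B Ξ) (hC : IsPrimitivePlucker e C Ξ) :
    B ≤ C := by
  obtain ⟨-, b, c, hc, hb⟩ := hB
  obtain ⟨-, b', c', hc', hb'⟩ := hC
  rw [← span_range_coe_basis b, ← span_range_coe_basis b']
  refine span_le_of_plucker (c := c / c') (coe_basis_linearIndependent b)
    (coe_basis_linearIndependent b') fun I => ?_
  rw [div_mul_eq_mul_div, ← hb, hb', mul_div_cancel_left₀ _ hc']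

/-- There are finitely many rational subspaces of bounded height. -/
theorem finite_rationalSubspaces_height_le (n e : ℕ) (H : ℝ) :
    {B | B ∈ rationalSubspaces n e ∧ height e B ≤ H}.Finite := by
  choose! Ξ hΞ hheight using
    fun (B : Submodule ℝ (EuclideanSpace ℝ (Fin n))) (hB : B ∈ rationalSubspaces n e) =>
      exists_isPrimitivePlucker_height_eq hB
  -- A primitive vector has entries bounded by the height and determines its subspace.
  refine Set.Finite.of_finite_image (f := Ξ)
    ((Set.finite_Icc (fun _ => -⌊H⌋) (fun _ => ⌊H⌋)).subset ?_) ?_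
  · rintro _ ⟨B, ⟨hB, hH⟩, rfl⟩
    have h (I) : |Ξ B I| ≤ ⌊H⌋ := by
      rw [Int.le_floor, Int.cast_abs]
      exact (abs_le_sqrt_sum_sq (fun I => (Ξ B I : ℝ)) I).trans ((hheight B hB).symm.trans_le hH)
    exact ⟨fun I => (abs_le.1 (h I)).1, fun I => (abs_le.1 (h I)).2⟩
  · rintro B ⟨hB, -⟩ C ⟨hC, -⟩ hBC
    have h1 := hΞ B hB
    have h2 := hΞ C hC
    rw [← hBC] at h2
    exact le_antisymm (h1.le h2) (h2.le h1)

end Plucker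

/-! ### Adding one dimension: lattice index, pigeonhole and height bound. -/

section Extension

variable {n ℓ : ℕ}

/-- The integer coefficient vectors `x` such that `∑ xₐ βₐ` is an integer vector. -/
def integralCoefficients (β : Fin ℓ → EuclideanSpace ℝ (Fin n)) : Submodule ℤ (Fin ℓ → ℤ) where
  carrier := {x | ∀ i, ∃ m : ℤ, ∑ a, (x a : ℝ) * β a i = m}
  zero_mem' := fun i => ⟨0, by simp⟩
  add_mem' := by
    intro x y hx hy i
    obtain ⟨m, hm⟩ := hx i
    obtain ⟨m', hm'⟩ := hy i
    exact ⟨m + m', by simp [add_mul, Finset.sum_add_distrib, hm, hm']⟩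
  smul_mem' := by
    intro c x hx i
    obtain ⟨m, hm⟩ := hx i
    exact ⟨c * m, by simp [mul_assoc, ← Finset.mul_sum, hm]⟩

theorem mem_integralCoefficients {β : Fin ℓ → EuclideanSpace ℝ (Fin n)} {x : Fin ℓ → ℤ} :
    x ∈ integralCoefficients β ↔ ∀ i, ∃ m : ℤ, ∑ a, (x a : ℝ) * β a i = m := Iff.rfl

/-- A `ℤ`-basis of the lattice has determinant `det f`, of absolute value the index. Applied to `β`
it gives integer vectors with minors `det f * Ξ J / Ξ I`; all of these being integers and `Ξ`
primitive, `Ξ I` divides `det f`. -/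
theorem natAbs_le_card_quotient_integralCoefficients {β : Fin ℓ → EuclideanSpace ℝ (Fin n)}
    {Ξ : (Fin ℓ ↪o Fin n) → ℤ} (hgcd : Finset.univ.gcd Ξ = 1) {I : Fin ℓ ↪o Fin n}
    (hI : Ξ I ≠ 0) (hβ : ∀ J, plucker β J = Ξ J / Ξ I)
    [Finite ((Fin ℓ → ℤ) ⧸ integralCoefficients β)] :
    (Ξ I).natAbs ≤ Nat.card ((Fin ℓ → ℤ) ⧸ integralCoefficients β) := by
  have hI' : (Ξ I : ℝ) ≠ 0 := by exact_mod_cast hI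
  let g : (Fin ℓ → ℤ) ≃ₗ[ℤ] integralCoefficients β := LinearEquiv.ofFinrankEq _ _
    ((Submodule.finiteQuotient_iff _).1 inferInstance).symm
  set f := (integralCoefficients β).subtype ∘ₗ AddMonoidHom.toIntLinearMap
    (g : (Fin ℓ → ℤ) →+ integralCoefficients β) with hf
  have hcard := Submodule.natAbs_det_equiv (integralCoefficients β) g
  rw [← hf] at hcard
  have hmem (a : Fin ℓ) : f (Pi.single a 1) ∈ integralCoefficients β := (g (Pi.single a 1)).2
  choose m hm using fun a => mem_integralCoefficients.1 (hmem a)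
  let T : Matrix (Fin ℓ) (Fin ℓ) ℝ := Matrix.of fun a k => (f (Pi.single a 1) k : ℝ)
  have hT : T.det = (LinearMap.det f : ℤ) := by
    have : T = ((LinearMap.toMatrix' f).map (Int.castRingHom ℝ)).transpose := by
      ext a k
      simp [T, LinearMap.toMatrix'_apply]
    rw [this, Matrix.det_transpose, ← LinearMap.det_toMatrix', ← eq_intCast (Int.castRingHom ℝ),
      RingHom.map_det]
    rfl
  let w : Fin ℓ → EuclideanSpace ℝ (Fin n) := fun a => ∑ k, T a k • β k
  have hw (J) : ∃ p : ℤ, ((LinearMap.det f : ℤ) / Ξ I : ℝ) * Ξ J = p := by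
    refine ⟨(Matrix.of fun a b : Fin ℓ => m a (J b)).det, ?_⟩
    have h1 := plucker_linearCombination (T := T) (v := β) (w := w) (fun a => rfl) J
    rw [hβ, hT] at h1
    rw [div_mul_eq_mul_div, ← mul_div_assoc] at *
    rw [← h1, plucker, ← eq_intCast (Int.castRingHom ℝ), RingHom.map_det]
    congr 1
    ext a b
    simp [w, T, ← hm]
  obtain ⟨p, hp⟩ := exists_int_eq_of_gcd_eq_one hgcd hw
  rw [div_eq_iff hI'] at hp
  have hp' : LinearMap.det f = p * Ξ I := by exact_mod_cast hp
  rw [← hcard, hp', Int.natAbs_mul]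
  refine Nat.le_mul_of_pos_left _ (Int.natAbs_pos.2 fun h0 => ?_)
  rw [hp', h0, zero_mul, Int.natAbs_zero] at hcard
  exact Nat.card_pos.ne hcard

/-- The pigeonhole principle provides a coefficient vector whose combination of the `βₐ` is close
to an integer vector without being one. -/
theorem exists_close_to_int {β : Fin ℓ → EuclideanSpace ℝ (Fin n)}
    {Ξ : (Fin ℓ ↪o Fin n) → ℤ} (hgcd : Finset.univ.gcd Ξ = 1) {I : Fin ℓ ↪o Fin n}
    (hI : Ξ I ≠ 0) (hβ : ∀ J, plucker β J = Ξ J / Ξ I)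
    (hone : ∀ a b, β a (I b) = if a = b then 1 else 0) {k : ℕ} (hk : 1 ≤ k)
    (hkI : k ^ (n - ℓ) < (Ξ I).natAbs) :
    ∃ x : Fin ℓ → ℤ, x ∉ integralCoefficients β ∧ ∃ w : Fin n → ℤ,
      (∀ b, w (I b) = x b) ∧ ∀ i, |w i - ∑ a, (x a : ℝ) * β a i| ≤ 1 / k := by
  have hk0 : (0 : ℝ) < k := by exact_mod_cast hk
  let s := {i : Fin n // i ∉ Finset.univ.image I}
  let u : (Fin ℓ → ℤ) → Fin n → ℝ := fun x i => ∑ a, (x a : ℝ) * β a i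
  have hu (x b) : u x (I b) = x b := by simp [u, hone]
  -- A class goes to the box of side `1 / k` containing the fractional parts of its representative.
  -- Only the `n - ℓ` columns outside `I` count, as `u x` is integral on `I`.
  let g : ((Fin ℓ → ℤ) ⧸ integralCoefficients β) → s → Fin k := fun q i =>
    ⟨⌊(k : ℝ) * Int.fract (u q.out i)⌋₊, by
      rw [Nat.floor_lt (mul_nonneg hk0.le (Int.fract_nonneg _))]
      exact mul_lt_of_lt_one_right hk0 (Int.fract_lt_one _)⟩
  -- Injectivity would itself make the quotient finite, with at most `k ^ (n - ℓ) < |Ξ I|` elements,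
  -- contradicting the index bound.
  have hg : ¬ Function.Injective g := by
    intro hg
    have : Finite ((Fin ℓ → ℤ) ⧸ integralCoefficients β) := Finite.of_injective g hg
    have h1 := natAbs_le_card_quotient_integralCoefficients hgcd hI hβ
    have h2 := Nat.card_le_card_of_injective g hg
    have h3 : Fintype.card s = n - ℓ := by
      rw [Fintype.card_subtype_compl, Fintype.card_fin, Fintype.card_coe,
        Finset.card_image_of_injective _ I.injective, Finset.card_univ, Fintype.card_fin]
    rw [Nat.card_eq_fintype_card (α := s → Fin k), Fintype.card_fun, Fintype.card_fin, h3] at h2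
    omega
  obtain ⟨q, q', hqq, hne⟩ : ∃ q q', g q = g q' ∧ q ≠ q' := by
    simpa [Function.Injective] using hg
  refine ⟨q.out - q'.out, fun h => hne ?_, fun i => ⌊u q.out i⌋ - ⌊u q'.out i⌋, fun b => ?_,
    fun i => ?_⟩
  · rw [← Submodule.Quotient.mk_out q, ← Submodule.Quotient.mk_out q']
    exact (Submodule.Quotient.eq _).2 h
  · simp [hu]
  have heq : ((⌊u q.out i⌋ - ⌊u q'.out i⌋ : ℤ) : ℝ) - ∑ a, (((q.out - q'.out) a : ℤ) : ℝ) * β a i =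
      Int.fract (u q'.out i) - Int.fract (u q.out i) := by
    have : ∑ a, (((q.out - q'.out) a : ℤ) : ℝ) * β a i = u q.out i - u q'.out i := by
      simp [u, sub_mul]
    rw [this, Int.fract, Int.fract]
    push_cast
    ring
  rw [heq]
  by_cases hi : i ∈ Finset.univ.image I
  · obtain ⟨b, -, rfl⟩ := Finset.mem_image.1 hi
    rw [hu, hu, Int.fract_intCast, Int.fract_intCast, sub_self, abs_zero]
    positivity
  · have h1 := congrArg Fin.val (congrFun hqq ⟨i, hi⟩)
    have h2 : ⌊(k : ℝ) * Int.fract (u q'.out i)⌋ = ⌊(k : ℝ) * Int.fract (u q.out i)⌋ := by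
      rw [← Int.natCast_floor_eq_floor (mul_nonneg hk0.le (Int.fract_nonneg _)),
        ← Int.natCast_floor_eq_floor (mul_nonneg hk0.le (Int.fract_nonneg _))]
      exact_mod_cast h1.symm
    have h3 := (Int.abs_sub_lt_one_of_floor_eq_floor h2).le
    rw [← mul_sub, abs_mul, abs_of_pos hk0] at h3
    rwa [le_div_iff₀ hk0, mul_comm]

/-- The primitive vector defining the height comes with some real basis; here it is expressed
through a rational one, which can be extended rationally. -/
theorem exists_rational_basis_primitive {B : Submodule ℝ (EuclideanSpace ℝ (Fin n))}
    (hB : B ∈ rationalSubspaces n ℓ) :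
    ∃ (v : Fin ℓ → EuclideanSpace ℝ (Fin n)) (Ξ : (Fin ℓ ↪o Fin n) → ℤ) (c : ℝ),
      LinearIndependent ℝ v ∧ Submodule.span ℝ (Set.range v) = B ∧
      (∀ i k, ∃ q : ℚ, v i k = q) ∧ Finset.univ.gcd Ξ = 1 ∧ c ≠ 0 ∧
      (∀ I, (Ξ I : ℝ) = c * plucker v I) ∧ height ℓ B = √(∑ I, (Ξ I : ℝ) ^ 2) := by
  obtain ⟨v, hv, hspan, hq⟩ := mem_rationalSubspaces_iff.1 hB
  obtain ⟨b, hb⟩ := exists_basis_of_span_eq hv hspan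
  obtain ⟨Ξ, hΞ, hheight⟩ := exists_isPrimitivePlucker_height_eq hB
  obtain ⟨I, hI⟩ := hΞ.exists_ne_zero
  obtain ⟨hgcd, b', c, hc, hcΞ⟩ := hΞ
  obtain ⟨t, ht⟩ := exists_plucker_basis_eq b b'
  simp only [hb] at ht
  have h (J) : (Ξ J : ℝ) = c * t * plucker v J := by rw [hcΞ, ht, mul_assoc]
  refine ⟨v, Ξ, c * t, hv, hspan, hq, hgcd, fun h0 => hI ?_, h, hheight⟩
  have := h I
  rw [h0, zero_mul] at this
  exact_mod_cast this

/-- A basis in reduced echelon form with respect to the columns `I`. -/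
theorem exists_reduced_of_plucker_ne_zero {v : Fin ℓ → EuclideanSpace ℝ (Fin n)}
    {I : Fin ℓ ↪o Fin n} (hI : plucker v I ≠ 0) :
    ∃ β : Fin ℓ → EuclideanSpace ℝ (Fin n), LinearIndependent ℝ β ∧
      Submodule.span ℝ (Set.range β) = Submodule.span ℝ (Set.range v) ∧
      (∀ J, plucker β J = plucker v J / plucker v I) ∧
      ∀ a b, β a (I b) = if a = b then 1 else 0 := by
  let V : Matrix (Fin ℓ) (Fin ℓ) ℝ := Matrix.of fun a b => v a (I b)
  let β : Fin ℓ → EuclideanSpace ℝ (Fin n) := fun a => ∑ k, V⁻¹ a k • v k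
  have hV : V⁻¹ * V = 1 := Matrix.nonsing_inv_mul V (isUnit_iff_ne_zero.2 hI)
  have hone (a b) : β a (I b) = if a = b then 1 else 0 := by
    have := congrFun (congrFun hV a) b
    rw [Matrix.mul_apply, Matrix.one_apply] at this
    rw [← this]
    simp [β, V]
  have hpl (J) : plucker β J = V⁻¹.det * plucker v J :=
    plucker_linearCombination (fun a => rfl) J
  have hdet : V⁻¹.det = (plucker v I)⁻¹ := by
    rw [Matrix.det_nonsing_inv, Ring.inverse_eq_inv']; rfl
  have hpl' (J) : plucker β J = plucker v J / plucker v I := by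
    rw [hpl, hdet, div_eq_inv_mul]
  have hβ : LinearIndependent ℝ β :=
    linearIndependent_of_plucker_ne_zero (I := I) (by rw [hpl', div_self hI]; exact one_ne_zero)
  have hv := linearIndependent_of_plucker_ne_zero hI
  refine ⟨β, hβ, le_antisymm (span_le_of_plucker hβ hv (c := plucker v I) fun J => ?_)
    (span_le_of_plucker hv hβ hpl), hpl', hone⟩
  rw [hpl', mul_div_cancel₀ _ hI]

/-- An integer vector outside of a rational subspace but close to it. -/
theorem exists_int_near_not_mem {v : Fin ℓ → EuclideanSpace ℝ (Fin n)}
    {Ξ : (Fin ℓ ↪o Fin n) → ℤ} {c : ℝ} (hℓ : ℓ < n) (hgcd : Finset.univ.gcd Ξ = 1) (hc : c ≠ 0)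
    (hΞ : ∀ J, (Ξ J : ℝ) = c * plucker v J) {I : Fin ℓ ↪o Fin n}
    (hI : Ξ I ≠ 0) {k : ℕ} (hk : 1 ≤ k) (hkI : k = 1 ∨ k ^ (n - ℓ) < (Ξ I).natAbs) :
    ∃ z : Fin n → ℤ, WithLp.toLp 2 (fun i => (z i : ℝ)) ∉ Submodule.span ℝ (Set.range v) ∧
      ∃ s ∈ Submodule.span ℝ (Set.range v), ∀ i, |z i - s i| ≤ 1 / k := by
  have hvI : plucker v I ≠ 0 := fun h => hI (by
    have := hΞ I
    rw [h, mul_zero] at this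
    exact_mod_cast this)
  rcases hkI with rfl | hkI
  -- For `k = 1` a standard basis vector outside the proper subspace will do, with `s = 0`.
  · by_contra! hcon
    have hmem (i : Fin n) : EuclideanSpace.basisFun (Fin n) ℝ i ∈
        Submodule.span ℝ (Set.range v) := by
      by_contra hi
      have heq : EuclideanSpace.basisFun (Fin n) ℝ i =
          WithLp.toLp 2 (fun m => ((Pi.single i 1 : Fin n → ℤ) m : ℝ)) := by
        ext m
        simp [Pi.single_apply]
      rw [heq] at hi
      obtain ⟨m, hm⟩ := hcon _ hi 0 (Submodule.zero_mem _)
      refine absurd hm (not_lt.2 ?_)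
      simp only [Pi.single_apply, PiLp.zero_apply]
      split_ifs <;> simp
    have htop : Submodule.span ℝ (Set.range v) = ⊤ := by
      rw [eq_top_iff, ← (EuclideanSpace.basisFun (Fin n) ℝ).toBasis.span_eq, Submodule.span_le]
      rintro _ ⟨i, rfl⟩
      simpa using hmem i
    have h1 := finrank_range_le_card (R := ℝ) v
    rw [Set.finrank, htop, finrank_top, finrank_euclideanSpace_fin, Fintype.card_fin] at h1
    omega
  obtain ⟨β, hβ, hspan, hpl, hone⟩ := exists_reduced_of_plucker_ne_zero hvI
  have hpl' (J) : plucker β J = Ξ J / Ξ I := by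
    rw [hpl, hΞ, hΞ, mul_div_mul_left _ _ hc]
  obtain ⟨x, hx, w, hwI, hw⟩ := exists_close_to_int hgcd hI hpl' hone hk hkI
  rw [← hspan]
  have hs (y : Fin ℓ → ℝ) (i) : (∑ a, y a • β a) i = ∑ a, y a * β a i := by simp
  refine ⟨w, fun hmem => hx ?_, ∑ a, (x a : ℝ) • β a, Submodule.sum_mem _ fun a _ =>
    Submodule.smul_mem _ _ (Submodule.subset_span ⟨a, rfl⟩), fun i => by rw [hs]; exact hw i⟩
  obtain ⟨y, hy⟩ := (Submodule.mem_span_range_iff_exists_fun ℝ).1 hmem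
  have hyi (i) : ∑ a, y a * β a i = w i := by rw [← hs, hy]
  -- The columns `I` read off the coefficients, so membership in the span would force `x` into the
  -- lattice.
  have hyx (b) : y b = x b := by
    rw [← hwI, ← hyi]; simp [hone]
  intro i
  exact ⟨w i, by rw [← hyi]; simp [hyx]⟩

/-- `k` has the order of `M ^ (1 / m)`. The alternative `k = 1` is needed only when `M ≤ 1`. -/
theorem exists_nat_pow_near_sandwich (M : ℕ) {m : ℕ} (hm : m ≠ 0) :
    ∃ k : ℕ, 1 ≤ k ∧ (k = 1 ∨ k ^ m < M) ∧ M ≤ (k + 1) ^ m := by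
  classical
  have h : ∃ t : ℕ, 1 ≤ t ∧ M ≤ (t + 1) ^ m :=
    ⟨M + 1, by omega, (by omega : M ≤ M + 1 + 1).trans (Nat.le_self_pow hm _)⟩
  refine ⟨Nat.find h, (Nat.find_spec h).1, ?_, (Nat.find_spec h).2⟩
  have h1 := (Nat.find_spec h).1
  rcases Nat.eq_or_lt_of_le h1 with h2 | h2
  · exact Or.inl h2.symm
  · have := Nat.find_min h (m := Nat.find h - 1) (by omega)
    rw [Nat.sub_add_cancel h1] at this
    refine Or.inr ?_
    by_contra! h3
    exact this ⟨by omega, h3⟩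

/-- Every rational subspace `B` is contained in a rational subspace of the next dimension of height
at most `≪ H(B) ^ (1 - 1 / codim B)`. -/
theorem exists_rational_succ (hℓ : ℓ < n) : ∃ K : ℝ, 0 ≤ K ∧ ∀ B ∈ rationalSubspaces n ℓ,
    ∃ C ∈ rationalSubspaces n (ℓ + 1), B ≤ C ∧
      height (ℓ + 1) C ≤ K * height ℓ B ^ (1 - 1 / ((n - ℓ : ℕ) : ℝ)) := by
  refine ⟨√(Fintype.card (Fin (ℓ + 1) ↪o Fin n)) * ((ℓ + 1) * 2), by positivity,
    fun B hB => ?_⟩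
  obtain ⟨v, Ξ, c, hv, hspan, hq, hgcd, hc, hΞ, hheight⟩ := exists_rational_basis_primitive hB
  obtain ⟨I₀, -⟩ := exists_plucker_ne_zero hv
  -- The largest minor allows the largest `k` and bounds all the coefficients in the expansion
  -- below.
  obtain ⟨I, -, hmax⟩ := Finset.exists_max_image Finset.univ (fun J => |Ξ J|) ⟨I₀, Finset.mem_univ _⟩
  have hI : Ξ I ≠ 0 := fun h => by
    have hz : Finset.univ.gcd Ξ = 0 := Finset.gcd_eq_zero_iff.2 fun J hJ => by
      have := hmax J hJ
      rw [h, abs_zero] at this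
      exact abs_nonpos_iff.1 this
    exact zero_ne_one (hz.symm.trans hgcd)
  have hm : n - ℓ ≠ 0 := by omega
  obtain ⟨k, hk, hkI, hkM⟩ := exists_nat_pow_near_sandwich (Ξ I).natAbs hm
  obtain ⟨z, hz, s, hs, hzs⟩ := exists_int_near_not_mem hℓ hgcd hc hΞ hI hk hkI
  set M : ℝ := |(Ξ I : ℝ)| with hMdef
  have hM (J) : |(Ξ J : ℝ)| ≤ M := by
    rw [hMdef]; exact_mod_cast hmax J (Finset.mem_univ _)
  have hM0 : 0 < M := abs_pos.2 (by exact_mod_cast hI)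
  have hk0 : (0 : ℝ) < k := by exact_mod_cast hk
  set Z : EuclideanSpace ℝ (Fin n) := WithLp.toLp 2 fun i => (z i : ℝ) with hZ
  set v' : Fin (ℓ + 1) → EuclideanSpace ℝ (Fin n) := Fin.cons Z v with hv'
  have hli : LinearIndependent ℝ v' := linearIndependent_finCons.2 ⟨hv, hz⟩
  have hC : Submodule.span ℝ (Set.range v') ∈ rationalSubspaces n (ℓ + 1) := by
    refine mem_rationalSubspaces_iff.2 ⟨v', hli, rfl, fun i m => ?_⟩
    refine Fin.cases ⟨z m, by simp [hv', hZ]⟩ (fun i => ?_) i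
    simpa [hv'] using hq i m
  let P : (Fin (ℓ + 1) ↪o Fin n) → ℤ := fun J =>
    ∑ a : Fin (ℓ + 1), (-1) ^ (a : ℕ) * z (J a) * Ξ ((Fin.succAboveOrderEmb a).trans J)
  have hP (J) : (P J : ℝ) = c * plucker v' J := by
    rw [hv', plucker_cons, Finset.mul_sum]
    push_cast [P]
    exact Finset.sum_congr rfl fun a _ => by rw [hΞ, hZ]; ring
  -- Since `s` lies in the span, its own expansion vanishes, so `z` may be replaced by the small
  -- vector `z - s`.
  have hPs (J) : (P J : ℝ) = ∑ a : Fin (ℓ + 1),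
      (-1) ^ (a : ℕ) * (z (J a) - s (J a)) * Ξ ((Fin.succAboveOrderEmb a).trans J) := by
    have h0 := (mem_span_range_iff_plucker_cons hv s).1 hs J
    rw [plucker_cons] at h0
    rw [hP, hv', plucker_cons, ← sub_zero (Finset.sum _ _), ← h0, ← Finset.sum_sub_distrib,
      Finset.mul_sum]
    exact Finset.sum_congr rfl fun a _ => by rw [hΞ, hZ]; ring
  have hPle (J) : |(P J : ℝ)| ≤ (ℓ + 1) * (M / k) := by
    rw [hPs]
    refine (Finset.abs_sum_le_sum_abs _ _).trans ?_
    refine (Finset.sum_le_card_nsmul _ _ (M / k) fun a _ => ?_).trans_eq (by simp)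
    rw [abs_mul, abs_mul, abs_pow, abs_neg, abs_one, one_pow, one_mul, div_eq_mul_one_div M,
      mul_comm M]
    exact mul_le_mul (hzs _) (hM _) (abs_nonneg _) (by positivity)
  obtain ⟨b, hb⟩ := exists_basis_of_span_eq hli rfl
  have hheightC : height (ℓ + 1) (Submodule.span ℝ (Set.range v')) ≤
      √(Fintype.card (Fin (ℓ + 1) ↪o Fin n)) * ((ℓ + 1) * (M / k)) := by
    refine (height_le_of_int_plucker hC b hc (P := P) (by simpa only [hb] using hP)).trans ?_
    refine Real.sqrt_le_iff.2 ⟨by positivity, ?_⟩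
    rw [mul_pow, Real.sq_sqrt (by positivity)]
    refine (Finset.sum_le_card_nsmul _ _ (((ℓ + 1) * (M / k)) ^ 2) fun J _ => ?_).trans_eq (by simp)
    exact sq_le_sq.2 ((hPle J).trans (le_abs_self _))
  refine ⟨_, hC, ?_, hheightC.trans ?_⟩
  · rw [← hspan]
    exact Submodule.span_mono (by rw [hv', Fin.range_cons]; exact Set.subset_insert _ _)
  rw [mul_assoc, mul_assoc]
  have hMH : M ≤ height ℓ B := by
    rw [hheight]; exact abs_le_sqrt_sum_sq (fun I => (Ξ I : ℝ)) I
  have hm1 : (1 : ℝ) ≤ ((n - ℓ : ℕ) : ℝ) := by exact_mod_cast Nat.one_le_iff_ne_zero.2 hm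
  have hexp : 0 ≤ 1 - 1 / ((n - ℓ : ℕ) : ℝ) := by
    rw [sub_nonneg, div_le_one (by linarith)]; exact hm1
  -- From `M ≤ (k + 1) ^ (n - ℓ)` and `k + 1 ≤ 2 * k`; this is the factor `2` in the constant.
  have hroot : M ^ (1 / ((n - ℓ : ℕ) : ℝ)) ≤ 2 * k := by
    rw [one_div, Real.rpow_inv_le_iff_of_pos hM0.le (by positivity) (by linarith),
      Real.rpow_natCast]
    have h1 : M ≤ ((k : ℝ) + 1) ^ (n - ℓ) := by
      have : ((Ξ I).natAbs : ℝ) ≤ ((k : ℝ) + 1) ^ (n - ℓ) := by exact_mod_cast hkM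
      rwa [Nat.cast_natAbs, Int.cast_abs] at this
    refine h1.trans (pow_le_pow_left₀ (by positivity) ?_ _)
    have : (1 : ℝ) ≤ k := by exact_mod_cast hk
    linarith
  have hMk : M / k ≤ 2 * height ℓ B ^ (1 - 1 / ((n - ℓ : ℕ) : ℝ)) := by
    refine le_trans ?_ (mul_le_mul_of_nonneg_left (Real.rpow_le_rpow hM0.le hMH hexp) zero_le_two)
    rw [Real.rpow_sub hM0, Real.rpow_one, div_le_iff₀ hk0, mul_div_assoc', div_mul_eq_mul_div,
      le_div_iff₀ (Real.rpow_pos_of_pos hM0 _)]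
    nlinarith
  gcongr

end Extension

/-! ### Iterating the extension and comparing exponents. -/

section Transference

variable {n e ℓ j : ℕ}

/-- Schmidt's going-up construction. -/
theorem exists_rational_superspace (hℓe : ℓ ≤ e) (he : e < n) :
    ∃ K : ℝ, 0 ≤ K ∧ ∀ B ∈ rationalSubspaces n ℓ, ∃ C ∈ rationalSubspaces n e, B ≤ C ∧
      height e C ≤ K * height ℓ B ^ (((n : ℝ) - e) / ((n : ℝ) - ℓ)) := by
  induction e, hℓe using Nat.le_induction with
  | base =>
    refine ⟨1, zero_le_one, fun B hB => ⟨B, hB, le_rfl, ?_⟩⟩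
    have : (n : ℝ) - ℓ ≠ 0 := sub_ne_zero.2 (by exact_mod_cast he.ne')
    rw [div_self this, Real.rpow_one, one_mul]
  | succ e hℓe ih =>
    obtain ⟨K, hK, h⟩ := ih (by omega)
    obtain ⟨K', hK', h'⟩ := exists_rational_succ (n := n) (ℓ := e) (by omega)
    have h1 : (0 : ℝ) < (n : ℝ) - e := sub_pos.2 (by exact_mod_cast (by omega : e < n))
    have h2 : (0 : ℝ) < (n : ℝ) - ℓ := sub_pos.2 (by exact_mod_cast (by omega : ℓ < n))
    have h3 : (e : ℝ) + 1 ≤ n := by exact_mod_cast he.le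
    have h4 : ((n - e : ℕ) : ℝ) = n - e := Nat.cast_sub (by omega)
    rw [h4] at h'
    have h5 : 0 ≤ 1 - 1 / ((n : ℝ) - e) := by
      rw [sub_nonneg, div_le_one h1]; linarith
    refine ⟨K' * K ^ (1 - 1 / ((n : ℝ) - e)), mul_nonneg hK' (Real.rpow_nonneg hK _),
      fun B hB => ?_⟩
    obtain ⟨C, hC, hBC, hle⟩ := h B hB
    obtain ⟨C', hC', hCC', hle'⟩ := h' C hC
    refine ⟨C', hC', hBC.trans hCC', hle'.trans ?_⟩
    have hB0 : 0 ≤ height ℓ B := zero_le_one.trans (one_le_height hB)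
    rw [mul_assoc]
    refine mul_le_mul_of_nonneg_left ?_ hK'
    refine (Real.rpow_le_rpow (zero_le_one.trans (one_le_height hC)) hle h5).trans_eq ?_
    rw [Real.mul_rpow hK (Real.rpow_nonneg hB0 _), ← Real.rpow_mul hB0]
    -- The exponents telescope: `(n - e) / (n - ℓ) * (1 - 1 / (n - e)) = (n - e - 1) / (n - ℓ)`.
    congr 2
    push_cast
    field_simp
    ring

theorem IsIrrational.mono {A : Submodule ℝ (EuclideanSpace ℝ (Fin n))} (hℓe : ℓ ≤ e) (he : e < n)
    (hA : IsIrrational A e j) : IsIrrational A ℓ j := by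
  obtain ⟨K, -, h⟩ := exists_rational_superspace hℓe he
  intro B hB
  obtain ⟨C, hC, hBC, -⟩ := h B hB
  exact (Submodule.finrank_mono (inf_le_inf_left A hBC)).trans_lt (hA C hC)

/-- Along infinitely many rational subspaces, negative powers of the height are arbitrarily
small. -/
theorem nonpos_of_infinite_height {S : Set (Submodule ℝ (EuclideanSpace ℝ (Fin n)))}
    (hS : S.Infinite) (hSr : S ⊆ rationalSubspaces n ℓ) {β t : ℝ} (hβ : 0 < β)
    (ht : ∀ B ∈ S, t ≤ 1 / height ℓ B ^ β) : t ≤ 0 := by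
  by_contra! ht0
  refine hS ((finite_rationalSubspaces_height_le n ℓ ((1 / t) ^ β⁻¹)).subset fun B hB =>
    ⟨hSr hB, ?_⟩)
  have hH : 0 < height ℓ B := zero_lt_one.trans_le (one_le_height (hSr hB))
  rw [Real.le_rpow_inv_iff_of_pos hH.le (by positivity) hβ]
  exact (le_one_div ht0 (Real.rpow_pos_of_pos hH _)).1 (ht B hB)

theorem ofReal_mul_mu_le {A : Submodule ℝ (EuclideanSpace ℝ (Fin n))} (hj : 1 ≤ j) (hjℓ : j ≤ ℓ)
    (hℓe : ℓ ≤ e) (he : e < n) (hjA : j ≤ finrank ℝ A) (hA : IsIrrational A e j) :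
    ENNReal.ofReal (((n : ℝ) - ℓ) / ((n : ℝ) - e)) * mu A ℓ j ≤ mu A e j := by
  have h1 : (0 : ℝ) < (n : ℝ) - e := sub_pos.2 (by exact_mod_cast he)
  have h2 : (0 : ℝ) < (n : ℝ) - ℓ := sub_pos.2 (by exact_mod_cast (by omega : ℓ < n))
  set r : ℝ := ((n : ℝ) - ℓ) / ((n : ℝ) - e) with hr
  have hr0 : 0 < r := div_pos h2 h1
  obtain ⟨K, hK, hext⟩ := exists_rational_superspace hℓe he
  have hr' : ((n : ℝ) - e) / ((n : ℝ) - ℓ) = r⁻¹ := by rw [hr, inv_div]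
  rw [hr'] at hext
  rw [mu, ENNReal.mul_sSup]
  refine iSup₂_le ?_
  rintro _ ⟨β, ⟨hβ, hinf⟩, rfl⟩
  rw [← ENNReal.ofReal_mul hr0.le]
  -- It suffices to reach every exponent below `r * β`; the slack pays for the constant `K`.
  refine le_of_forall_lt_imp_le_of_dense fun a ha => ?_
  have haγ := ENNReal.ofReal_toReal (ha.trans ENNReal.ofReal_lt_top).ne
  rw [← haγ] at ha ⊢
  clear haγ
  set γ := a.toReal with hγ
  rcases (ENNReal.toReal_nonneg (a := a)).eq_or_lt with h0 | hγ0
  · rw [hγ, ← h0, ENNReal.ofReal_zero]; exact zero_le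
  have hγβ : γ < r * β := (ENNReal.ofReal_lt_ofReal_iff (by positivity)).1 ha
  refine le_sSup ⟨γ, ⟨hγ0, ?_⟩, rfl⟩
  set S := {B | B ∈ rationalSubspaces n ℓ ∧ psi A B j ≤ 1 / height ℓ B ^ β} with hS
  choose! F hF hBF hFle using hext
  have hpsi (B) (hB : B ∈ S) : psi A (F B) j ≤ 1 / height ℓ B ^ β :=
    (psi_anti (hBF B hB.1) hj hjA (hjℓ.trans_eq hB.1.2.symm)).trans hB.2
  -- Otherwise some `C` has an infinite fibre; heights are unbounded along it, so `ψⱼ(A, C) = 0`,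
  -- which irrationality excludes.
  have himage : (F '' S).Infinite := by
    intro hfin
    obtain ⟨C, ⟨B₀, hB₀, rfl⟩, hC⟩ : ∃ C ∈ F '' S, (S ∩ F ⁻¹' {C}).Infinite := by
      by_contra! hcon
      refine hinf ((hfin.biUnion fun C hC => hcon C hC).subset fun B hB => ?_)
      exact Set.mem_biUnion (Set.mem_image_of_mem F hB) ⟨hB, rfl⟩
    have hle : psi A (F B₀) j ≤ 0 := nonpos_of_infinite_height hC (fun B hB => hB.1.1) hβ
      fun B hB => by rw [← Set.mem_singleton_iff.1 hB.2]; exact hpsi B hB.1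
    have hrat := hF B₀ hB₀.1
    exact (hA _ hrat).not_ge (le_finrank_inf_of_psi_nonpos hj hjA
      ((hjℓ.trans hℓe).trans_eq hrat.2.symm) hle)
  have hδ : 0 < r * β - γ := sub_pos.2 hγβ
  -- The finitely many `C` of small height are dropped; for the others `H(C) ^ (r * β - γ)` exceeds
  -- `K ^ (r * β)`.
  refine (himage.sdiff (finite_rationalSubspaces_height_le n e
    ((K ^ (r * β)) ^ (r * β - γ)⁻¹))).mono ?_
  rintro _ ⟨⟨B, hB, rfl⟩, hlarge⟩
  have hC := hF B hB.1
  refine ⟨hC, (hpsi B hB).trans ?_⟩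
  have hC0 : 0 < height e (F B) := zero_lt_one.trans_le (one_le_height hC)
  have hB0 : 0 < height ℓ B := zero_lt_one.trans_le (one_le_height hB.1)
  have hlarge' : K ^ (r * β) ≤ height e (F B) ^ (r * β - γ) := by
    have : (K ^ (r * β)) ^ (r * β - γ)⁻¹ < height e (F B) := lt_of_not_ge fun h => hlarge ⟨hC, h⟩
    exact ((Real.rpow_inv_lt_iff_of_pos (Real.rpow_nonneg hK _) hC0.le hδ).1 this).le
  have hbound : height e (F B) ^ (r * β) ≤ K ^ (r * β) * height ℓ B ^ β := by
    refine (Real.rpow_le_rpow hC0.le (hFle B hB.1) (by positivity)).trans_eq ?_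
    rw [Real.mul_rpow hK (Real.rpow_nonneg hB0.le _), ← Real.rpow_mul hB0.le,
      inv_mul_cancel_left₀ hr0.ne']
  refine one_div_le_one_div_of_le (Real.rpow_pos_of_pos hC0 _) ?_
  have hsplit : height e (F B) ^ (r * β) =
      height e (F B) ^ (r * β - γ) * height e (F B) ^ γ := by
    rw [← Real.rpow_add hC0, sub_add_cancel]
  rw [hsplit] at hbound
  refine le_of_mul_le_mul_left (hbound.trans ?_) (Real.rpow_pos_of_pos hC0 (r * β - γ))
  exact mul_le_mul_of_nonneg_right hlarge' (Real.rpow_nonneg hB0.le _)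

end Transference

end SubspaceApprox

theorem mainTheorem4 (n d e ℓ j : ℕ) (hj : 1 ≤ j) (hjℓ : j ≤ ℓ) (hℓe : ℓ ≤ e) (hjd : j ≤ d)
    (hde : d + e ≤ n) :
    (∀ A ∈ SubspaceApprox.irrationalSubspaces n d e j,
      A ∈ SubspaceApprox.irrationalSubspaces n d ℓ j ∧
      SubspaceApprox.mu A e j ≥
        ENNReal.ofReal (((n : ℝ) - (ℓ : ℝ)) / ((n : ℝ) - (e : ℝ))) * SubspaceApprox.mu A ℓ j) ∧
    SubspaceApprox.muInf n d e j ≥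
      ENNReal.ofReal (((n : ℝ) - (ℓ : ℝ)) / ((n : ℝ) - (e : ℝ))) *
        SubspaceApprox.muInf n d ℓ j := by
  have he : e < n := by omega
  have h : ∀ A ∈ SubspaceApprox.irrationalSubspaces n d e j,
      A ∈ SubspaceApprox.irrationalSubspaces n d ℓ j ∧
      SubspaceApprox.mu A e j ≥
        ENNReal.ofReal (((n : ℝ) - (ℓ : ℝ)) / ((n : ℝ) - (e : ℝ))) * SubspaceApprox.mu A ℓ j :=
    fun A hA => ⟨⟨hA.1, SubspaceApprox.IsIrrational.mono hℓe he hA.2⟩,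
      SubspaceApprox.ofReal_mul_mu_le hj hjℓ hℓe he (hjd.trans_eq hA.1.symm) hA.2⟩
  refine ⟨h, le_iInf₂ fun A hA => ?_⟩
  exact (mul_le_mul_right (iInf₂_le A (h A hA).1) _).trans (h A hA).2
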